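/- Let $(\Omega,\mathcal F,\mathbb P,(\mathcal F_t)_{t\ge 0})$ be a filtered probability space. An $\mathbb R^n$-valued process $X=(X_t)_{t\ge0}$ is called an $n$-dimensional Lévy process if (a) $X_t$ is $\mathcal F_t$-measurable for every $t\ge 0$; (b) $X_0=0$ a.s.; (c) for all $s,t\ge0$, $X_{t+s}-X_t$ is independent of $\mathcal F_t$ and has the same law as $X_s$; (d) $(X_t)_t$ is continuous in probability. Theorem. Let $X$ be an $n$-dimensional Lévy process with (almost surely) continuous sample paths. Then there exist $\gamma\in\mathbb R^n$ and a symmetric non-negative definite $n\times n$ real matrix $A$ such that $$\mathbb E\left[e^{i\langle u,X_t\rangle}\right]=\exp\left(i\langle u,\gamma\rangle t-\tfrac12\langle u,Au\rangle t\right)\qquad\text{for all } t\ge0,\ u\in\mathbb R^n,$$ and $X$ is an $n$-dimensional arithmetic Brownian motion with drift $\gamma$ and covariance matrix $A$; that is, $X_0=0$ a.s., $X$ has independent increments, $X_t-X_s$ has the (possibly degenerate) Gaussian law $N((t-s)\gamma,(t-s)A)$ for all $0\le s\le t$, and almost every sample path of $X$ is continuous. -/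

import Mathlib

open MeasureTheory ProbabilityTheory Filter Topology
open scoped NNReal Matrix

/-- An `n`-dimensional Lévy process `X` on the filtered probability space `(Ω, mΩ, P, ℱ)`. -/
structure IsLevyProcess {n : ℕ} {Ω : Type*} {mΩ : MeasurableSpace Ω}
    (X : ℝ≥0 → Ω → EuclideanSpace ℝ (Fin n)) (ℱ : Filtration ℝ≥0 mΩ) (P : Measure Ω) : Prop where
  adapted : ∀ t, Measurable[ℱ t] (X t)
  zero : ∀ᵐ ω ∂P, X 0 ω = 0
  /-- `X (t + s) - X t` is independent of the sigma-algebra `ℱ t`. -/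
  indep : ∀ t s, Indep (MeasurableSpace.comap (X (t + s) - X t) inferInstance) (ℱ t) P
  /-- `X (t + s) - X t` has the same law as `X s`. -/
  stationary : ∀ t s, IdentDistrib (X (t + s) - X t) (X s) P P
  continuous_in_probability : ∀ t, TendstoInMeasure P X (𝓝 t) (X t)

/-- `X` is an `n`-dimensional (arithmetic) Brownian motion with drift vector `γ` and covariance
matrix `A` (which is meant to be symmetric and non-negative definite, possibly singular):
it starts at `0`, has independent increments, has `N((t - s) γ, (t - s) A)`-distributed
increments, and has continuous paths. -/
structure IsArithmeticBrownianMotion {n : ℕ} {Ω : Type*} {mΩ : MeasurableSpace Ω}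
    (X : ℝ≥0 → Ω → EuclideanSpace ℝ (Fin n)) (γ : EuclideanSpace ℝ (Fin n))
    (A : Matrix (Fin n) (Fin n) ℝ) (P : Measure Ω) : Prop where
  zero : ∀ᵐ ω ∂P, X 0 ω = 0
  indep_increments : HasIndepIncrements X P
  law_increments : ∀ s t : ℝ≥0, s ≤ t →
    HasLaw (X t - X s)
      (multivariateGaussian (((t : ℝ) - (s : ℝ)) • γ) (((t : ℝ) - (s : ℝ)) • A)) P
  continuous_paths : ∀ᵐ ω ∂P, Continuous fun t => X t ω

/-! Independence and stationarity of increments make `t ↦ E exp(i⟨u, X_t⟩)` multiplicative. It is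
also continuous, so it equals `exp(t ψ(u))`, and `ψ(u)` is the limit of `N (E exp(i⟨u, X_{1/N}⟩) -
1)`. It remains to see that `ψ` is a Gaussian exponent.

Paths are uniformly continuous on `[0, 1]`, so the probability that all `N` increments of mesh `1/N`
are at most `ε` tends to 1. That probability is `(1 - p)^N` with `p = P(‖X_{1/N}‖ > ε)`, hence `N p
→ 0` (`tendsto_mul_measure_norm_gt`). Thus `ψ(u)` is also the limit of `∫ (exp(i⟨u, x⟩) - 1) dν_j`,
where `ν_j` is `N_j` times the law of `X_{1/N_j}` restricted to a ball of radius tending to 0.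

On such balls only the first two Taylor terms survive (`tendsto_drift_variance_of_small_support`).
So `Im ψ` is a limit of linear forms and `-2 Re ψ` a limit of non-negative quadratic forms, which
yields `γ` and `A`. -/

/-- A continuous multiplicative function on `[0, ∞)` is an exponential. -/
theorem exists_eq_exp_mul_of_continuous_of_add {f : ℝ≥0 → ℂ} (hf : Continuous f) (h0 : f 0 = 1)
    (hadd : ∀ s t, f (s + t) = f s * f t) :
    ∃ z : ℂ, ∀ t : ℝ≥0, f t = Complex.exp (z * ((t : ℝ) : ℂ)) := by
  set g : ℝ → ℂ := fun x => f x.toNNReal with hg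
  have hgc : Continuous g := hf.comp continuous_real_toNNReal
  have hg0 : g 0 = 1 := by simp [hg, h0]
  have hgadd : ∀ x y : ℝ, 0 ≤ x → 0 ≤ y → g (x + y) = g x * g y := fun x y hx hy => by
    simp only [hg, Real.toNNReal_add hx hy, hadd]
  -- Integrating gains regularity: `g x * F c = F (x + c) - F x`, so `g` is differentiable as soon
  -- as `F c ≠ 0`. Such `c` exists because `F' 0 = g 0 = 1`.
  set F : ℝ → ℂ := fun x => ∫ s in (0 : ℝ)..x, g s with hF
  have hFd : ∀ x, HasDerivAt F (g x) x := fun x =>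
    intervalIntegral.integral_hasDerivAt_right (hgc.intervalIntegrable _ _)
      (hgc.stronglyMeasurableAtFilter _ _) hgc.continuousAt
  have hF0 : F 0 = 0 := by simp [hF]
  obtain ⟨c, hc, hFc⟩ : ∃ c : ℝ, 0 < c ∧ F c ≠ 0 := by
    have := (hFd 0).eventually_ne (c := F 0) (by rw [hg0]; exact one_ne_zero)
    have h2 : ∀ᶠ x in 𝓝[>] (0 : ℝ), F x ≠ F 0 :=
      this.filter_mono (nhdsWithin_mono _ fun x hx => ne_of_gt hx)
    obtain ⟨c, h1, h2⟩ := (h2.and self_mem_nhdsWithin).exists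
    exact ⟨c, h2, hF0 ▸ h1⟩
  have hrep : ∀ x : ℝ, 0 ≤ x → g x = (F (x + c) - F x) / F c := by
    intro x hx
    rw [eq_div_iff hFc]
    have h1 : F (x + c) - F x = ∫ s in x..(x + c), g s :=
      intervalIntegral.integral_interval_sub_left (hgc.intervalIntegrable _ _)
        (hgc.intervalIntegrable _ _)
    have h2 : ∫ s in x..(x + c), g s = ∫ s in (0 : ℝ)..c, g (x + s) := by
      rw [intervalIntegral.integral_comp_add_left]; simp
    rw [h1, h2, hF, ← intervalIntegral.integral_const_mul]
    refine intervalIntegral.integral_congr fun s hs => ?_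
    rw [Set.uIcc_of_le hc.le] at hs
    exact (hgadd x s hx hs.1).symm
  set z : ℂ := (g c - 1) / F c with hz
  -- Only a right derivative: the representation of `g` holds for `x ≥ 0` alone. It suffices to make
  -- `g y * exp (-z y)` constant.
  have hgd : ∀ x : ℝ, 0 ≤ x → HasDerivWithinAt g (z * g x) (Set.Ici x) x := by
    intro x hx
    have h1 : HasDerivAt (fun y => (F (y + c) - F y) / F c) ((g (x + c) - g x) / F c) x :=
      (((hFd (x + c)).comp_add_const x c).sub (hFd x)).div_const _
    have h2 : (g (x + c) - g x) / F c = z * g x := by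
      rw [hgadd x c hx hc.le, hz]; ring
    rw [h2] at h1
    exact h1.hasDerivWithinAt.congr (fun y hy => hrep y (hx.trans hy)) (hrep x hx)
  refine ⟨z, fun t => ?_⟩
  have hE : ∀ x : ℝ, HasDerivAt (fun y : ℝ => Complex.exp (-z * (y : ℂ)))
      (Complex.exp (-z * (x : ℂ)) * -z) x := fun x => by
    simpa using ((Complex.ofRealCLM.hasDerivAt (x := x)).const_mul (-z)).cexp
  have hconst := constant_of_has_deriv_right_zero (a := 0) (b := (t : ℝ))
    (f := fun y : ℝ => g y * Complex.exp (-z * (y : ℂ))) (by fun_prop) (fun x hx => by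
      have h := (hgd x hx.1).mul (hE x).hasDerivWithinAt (s := Set.Ici x)
      rwa [show z * g x * Complex.exp (-z * x) + g x * (Complex.exp (-z * x) * -z) = 0 by ring] at h) t ⟨t.2, le_rfl⟩
  have hgt : g t = f t := by simp [hg]
  simp only [hg0, hgt, Complex.ofReal_zero, mul_zero, Complex.exp_zero, one_mul, neg_mul,
    Complex.exp_neg] at hconst
  exact (mul_inv_eq_one₀ (Complex.exp_ne_zero _)).1 hconst

/-- Third order Taylor bound for the characteristic exponential. -/
theorem norm_cexp_mul_I_sub_taylor_le {y : ℝ} (hy : |y| ≤ 1) :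
    ‖Complex.exp (y * Complex.I) - 1 - (y * Complex.I - (y ^ 2 : ℝ) / 2)‖ ≤ |y| * y ^ 2 := by
  have h := Complex.exp_bound (x := y * Complex.I) (by simpa using hy) (n := 3) (by norm_num)
  have e : Complex.exp (y * Complex.I) - ∑ m ∈ Finset.range 3, (y * Complex.I) ^ m / m.factorial
      = Complex.exp (y * Complex.I) - 1 - (y * Complex.I - (y ^ 2 : ℝ) / 2) := by
    simp [Finset.sum_range_succ, mul_pow]; ring
  rw [e] at h
  refine h.trans ?_
  have : ‖(y : ℂ) * Complex.I‖ = |y| := by simp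
  rw [this, ← sq_abs y, ← pow_succ']
  -- The remainder constant is `4 / (3! * 3) = 2/9`.
  refine mul_le_of_le_one_right (by positivity) ?_
  norm_num [Nat.factorial]

/-! ### Limits of measures on shrinking balls -/

section SmallJumps

variable {E : Type*} [NormedAddCommGroup E] [InnerProductSpace ℝ E] [MeasurableSpace E]
  [BorelSpace E] [SecondCountableTopology E]

/-- If finite measures concentrated on shrinking balls have converging compensated characteristic
functions, then the drift and covariance parts converge separately. -/
theorem tendsto_drift_variance_of_small_support {ν : ℕ → Measure E} [∀ j, IsFiniteMeasure (ν j)]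
    {ε : ℕ → ℝ} (hε : Tendsto ε atTop (𝓝 0)) (hν : ∀ j, ∀ᵐ x ∂ν j, ‖x‖ ≤ ε j) {u : E} {z : ℂ}
    (hz : Tendsto (fun j => ∫ x, (Complex.exp ((inner ℝ u x : ℝ) * Complex.I) - 1) ∂ν j)
      atTop (𝓝 z)) :
    Tendsto (fun j => ∫ x, (inner ℝ u x : ℝ) ∂ν j) atTop (𝓝 z.im) ∧
    Tendsto (fun j => ∫ x, (inner ℝ u x : ℝ) ^ 2 ∂ν j) atTop (𝓝 (-2 * z.re)) := by
  have hb : ∀ j, ∀ᵐ x ∂ν j, |(inner ℝ u x : ℝ)| ≤ ‖u‖ * ε j := fun j => by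
    filter_upwards [hν j] with x hx
    exact (abs_real_inner_le_norm u x).trans (by gcongr)
  have hi1 : ∀ j, Integrable (fun x => (inner ℝ u x : ℝ)) (ν j) := fun j =>
    Integrable.of_bound (by fun_prop) _ (hb j)
  have hi2 : ∀ j, Integrable (fun x => (inner ℝ u x : ℝ) ^ 2) (ν j) := fun j =>
    Integrable.of_bound (by fun_prop) ((‖u‖ * ε j) ^ 2) (by
      filter_upwards [hb j] with x hx
      rw [Real.norm_eq_abs, abs_pow]; gcongr)
  have hie : ∀ j, Integrable (fun x => Complex.exp ((inner ℝ u x : ℝ) * Complex.I) - 1) (ν j) :=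
    fun j => Integrable.of_bound (by fun_prop) 2 (.of_forall fun x => by
      refine (norm_sub_le _ _).trans ?_
      rw [Complex.norm_exp_ofReal_mul_I]; norm_num)
  set q : ℕ → ℝ := fun j => ∫ x, (inner ℝ u x : ℝ) ^ 2 ∂ν j with hq
  set I : ℕ → ℂ := fun j => ∫ x, (Complex.exp ((inner ℝ u x : ℝ) * Complex.I) - 1) ∂ν j with hI
  have hsmall : ∀ᶠ j in atTop, ‖u‖ * ε j ≤ 1 := by
    have : Tendsto (fun j => ‖u‖ * ε j) atTop (𝓝 (‖u‖ * 0)) := hε.const_mul _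
    rw [mul_zero] at this
    exact this.eventually_le_const one_pos
  have hre : ∀ j, (I j).re = ∫ x, (Real.cos (inner ℝ u x : ℝ) - 1) ∂ν j := fun j => by
    rw [hI]
    change RCLike.re (∫ x, (Complex.exp ((inner ℝ u x : ℝ) * Complex.I) - 1) ∂ν j) = _
    rw [← integral_re (hie j)]
    refine integral_congr_ae (.of_forall fun x => ?_)
    simp [Complex.exp_ofReal_mul_I_re]
  have hreI : ∀ j, Integrable (fun x => Real.cos (inner ℝ u x : ℝ) - 1) (ν j) := fun j =>
    (hie j).re.congr (.of_forall fun x => by simp [Complex.exp_ofReal_mul_I_re])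
  -- The masses of `ν j` need not be bounded, but the second moments are: `cos y ≤ 1 - 2 y² / π²`
  -- for `|y| ≤ π` controls them by the convergent real parts.
  have hqle : ∀ᶠ j in atTop, q j ≤ -(Real.pi ^ 2 / 2) * (I j).re := by
    filter_upwards [hsmall] with j hj
    rw [hre, ← integral_const_mul]
    refine integral_mono_ae (hi2 j) ((hreI j).const_mul _) ?_
    filter_upwards [hb j] with x hx
    have h := Real.cos_le_one_sub_mul_cos_sq (x := (inner ℝ u x : ℝ))
      (hx.trans (hj.trans (by linarith [Real.pi_gt_three])))
    have hpi := Real.pi_pos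
    have : (Real.pi ^ 2 / 2) * (2 / Real.pi ^ 2 * (inner ℝ u x : ℝ) ^ 2)
        ≤ (Real.pi ^ 2 / 2) * (1 - Real.cos (inner ℝ u x : ℝ)) := by
      gcongr; linarith
    have e : (Real.pi ^ 2 / 2) * (2 / Real.pi ^ 2 * (inner ℝ u x : ℝ) ^ 2)
      = (inner ℝ u x : ℝ) ^ 2 := by field_simp
    linarith
  have hreT : Tendsto (fun j => (I j).re) atTop (𝓝 z.re) := (Complex.continuous_re.tendsto z).comp hz
  have hqb : ∀ᶠ j in atTop, q j ≤ -(Real.pi ^ 2 / 2) * z.re + 1 := by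
    filter_upwards [hqle, (hreT.const_mul (-(Real.pi ^ 2 / 2))).eventually_le_const
      (lt_add_one _)] with j h1 h2 using h1.trans h2
  set T : ℕ → ℂ := fun j => ((∫ x, (inner ℝ u x : ℝ) ∂ν j : ℝ) : ℂ) * Complex.I - (q j : ℂ) / 2
    with hT
  -- The cubic error is at most `‖u‖ ε_j` times the bounded second moment, so `T j` has the same
  -- limit as `I j`.
  have herr : ∀ᶠ j in atTop, ‖I j - T j‖ ≤ ‖u‖ * ε j * q j := by
    filter_upwards [hsmall] with j hj
    have hc1 : Integrable (fun x => ((inner ℝ u x : ℝ) : ℂ) * Complex.I) (ν j) :=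
      (hi1 j).ofReal.mul_const _
    have hc2 : Integrable (fun x => (((inner ℝ u x : ℝ) ^ 2 : ℝ) : ℂ) / 2) (ν j) :=
      (hi2 j).ofReal.div_const _
    have e : T j = ∫ x, (((inner ℝ u x : ℝ) : ℂ) * Complex.I
        - (((inner ℝ u x : ℝ) ^ 2 : ℝ) : ℂ) / 2) ∂ν j := by
      rw [integral_sub hc1 hc2, integral_mul_const, integral_div, integral_complex_ofReal,
        integral_complex_ofReal]
    simp only [e, hI, hq]
    rw [← integral_sub (hie j) (by exact hc1.sub hc2), ← integral_const_mul]
    refine norm_integral_le_of_norm_le ((hi2 j).const_mul _) ?_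
    filter_upwards [hb j] with x hx
    refine (norm_cexp_mul_I_sub_taylor_le (hx.trans hj)).trans ?_
    gcongr
  have hq0 : ∀ j, 0 ≤ q j := fun j => integral_nonneg fun x => sq_nonneg _
  have hTt : Tendsto T atTop (𝓝 z) := by
    have h1 : Tendsto (fun j => I j - T j) atTop (𝓝 0) := by
      refine squeeze_zero_norm' (a := fun j => ‖u‖ * |ε j| * (-(Real.pi ^ 2 / 2) * z.re + 1)) ?_ ?_
      · filter_upwards [herr, hqb] with j h1 h2
        refine h1.trans ?_
        have := hq0 j
        gcongr
        exact le_abs_self _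
      · have := ((hε.abs.const_mul ‖u‖).mul_const (-(Real.pi ^ 2 / 2) * z.re + 1))
        simpa using this
    simpa using hz.sub h1
  constructor
  · have := (Complex.continuous_im.tendsto z).comp hTt
    refine this.congr fun j => ?_
    simp [hT]
  · have := ((Complex.continuous_re.tendsto z).comp hTt).const_mul (-2)
    refine this.congr fun j => ?_
    simp [hT]; ring

end SmallJumps

/-- A pointwise limit of compensated characteristic functions of finite measures concentrated on
shrinking balls is a Gaussian exponent. -/
theorem exists_gaussian_exponent_of_small_support {n : ℕ}
    {ν : ℕ → Measure (EuclideanSpace ℝ (Fin n))} [∀ j, IsFiniteMeasure (ν j)]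
    {ε : ℕ → ℝ} (hε : Tendsto ε atTop (𝓝 0)) (hν : ∀ j, ∀ᵐ x ∂ν j, ‖x‖ ≤ ε j)
    {ψ : EuclideanSpace ℝ (Fin n) → ℂ}
    (hψ : ∀ u, Tendsto (fun j => ∫ x, (Complex.exp ((inner ℝ u x : ℝ) * Complex.I) - 1) ∂ν j)
      atTop (𝓝 (ψ u))) :
    ∃ (γ : EuclideanSpace ℝ (Fin n)) (A : Matrix (Fin n) (Fin n) ℝ), A.PosSemidef ∧
      ∀ u, ψ u = (inner ℝ u γ : ℝ) * Complex.I - ((u ⬝ᵥ A *ᵥ u : ℝ) : ℂ) / 2 := by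
  have h1 u := (tendsto_drift_variance_of_small_support hε hν (hψ u)).1
  have h2 u := (tendsto_drift_variance_of_small_support hε hν (hψ u)).2
  let e : Fin n → EuclideanSpace ℝ (Fin n) := fun i => EuclideanSpace.single i 1
  have hin : ∀ i x, (inner ℝ (e i) x : ℝ) = x i := fun i x => by
    simp [e, EuclideanSpace.inner_single_left]
  have hbi : ∀ j i, ∀ᵐ x ∂ν j, |x i| ≤ ε j := fun j i => by
    filter_upwards [hν j] with x hx using (PiLp.norm_apply_le x i).trans hx
  have hi1 : ∀ j i, Integrable (fun x => x i) (ν j) := fun j i =>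
    Integrable.of_bound (by fun_prop) _ (hbi j i)
  have hi2 : ∀ j i k, Integrable (fun x => x i * x k) (ν j) := fun j i k =>
    Integrable.of_bound (by fun_prop) (ε j * ε j) (by
      filter_upwards [hbi j i, hbi j k] with x h h'
      rw [Real.norm_eq_abs, abs_mul]
      gcongr
      exact (abs_nonneg _).trans h)
  -- Polarization of the limiting quadratic form `-2 Re ψ` on basis vectors.
  let A : Matrix (Fin n) (Fin n) ℝ := fun i k =>
    ((-2 * (ψ (e i + e k)).re) - (-2 * (ψ (e i)).re) - (-2 * (ψ (e k)).re)) / 2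
  have hA : ∀ i k, Tendsto (fun j => ∫ x, x i * x k ∂ν j) atTop (𝓝 (A i k)) := by
    intro i k
    refine ((((h2 (e i + e k)).sub (h2 (e i))).sub (h2 (e k))).div_const 2).congr fun j => ?_
    simp only [inner_add_left, hin]
    have s1 : Integrable (fun x : EuclideanSpace ℝ (Fin n) => (x i + x k) ^ 2) (ν j) := by
      refine (((hi2 j i i).add ((hi2 j i k).const_mul 2)).add (hi2 j k k)).congr
        (.of_forall fun x => ?_)
      simp only [Pi.add_apply]; ring
    have s2 : ∀ i, Integrable (fun x : EuclideanSpace ℝ (Fin n) => x i ^ 2) (ν j) := fun i =>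
      (hi2 j i i).congr (.of_forall fun x => (sq _).symm)
    rw [← integral_sub s1 (s2 i), ← integral_sub (by exact s1.sub (s2 i)) (s2 k), ← integral_div]
    refine integral_congr_ae (.of_forall fun x => ?_)
    ring
  have hq : ∀ u : EuclideanSpace ℝ (Fin n), u ⬝ᵥ A *ᵥ u = -2 * (ψ u).re := by
    intro u
    refine tendsto_nhds_unique ?_ (h2 u)
    have : Tendsto (fun j => ∑ i, ∑ k, u i * (∫ x, x i * x k ∂ν j) * u k) atTop
        (𝓝 (∑ i, ∑ k, u i * A i k * u k)) :=
      tendsto_finsetSum _ fun i _ => tendsto_finsetSum _ fun k _ =>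
        ((hA i k).const_mul _).mul_const _
    have e1 : u ⬝ᵥ A *ᵥ u = ∑ i, ∑ k, u i * A i k * u k := by
      simp [dotProduct, Matrix.mulVec, Finset.mul_sum, mul_assoc]
    rw [e1]
    refine this.congr fun j => ?_
    simp_rw [← integral_const_mul, ← integral_mul_const]
    have hi3 : ∀ i k, Integrable (fun x => u i * (x i * x k) * u k) (ν j) := fun i k =>
      ((hi2 j i k).const_mul _).mul_const _
    have e2 : ∀ x : EuclideanSpace ℝ (Fin n), (inner ℝ u x : ℝ) ^ 2
        = ∑ i, ∑ k, u i * (x i * x k) * u k := by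
      intro x
      rw [sq, PiLp.inner_apply, Finset.sum_mul_sum]
      refine Finset.sum_congr rfl fun i _ => Finset.sum_congr rfl fun k _ => ?_
      simp only [RCLike.inner_apply, conj_trivial]; ring
    simp_rw [e2]
    rw [integral_finsetSum _ fun i _ => integrable_finsetSum _ fun k _ => hi3 i k]
    refine Finset.sum_congr rfl fun i _ => ?_
    rw [integral_finsetSum _ fun k _ => hi3 i k]
  let γ : EuclideanSpace ℝ (Fin n) := WithLp.toLp 2 fun i => (ψ (e i)).im
  have hγ : ∀ u, (inner ℝ u γ : ℝ) = (ψ u).im := by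
    intro u
    refine tendsto_nhds_unique ?_ (h1 u)
    have : Tendsto (fun j => ∑ i, u i * ∫ x, (inner ℝ (e i) x : ℝ) ∂ν j) atTop
        (𝓝 (∑ i, u i * (ψ (e i)).im)) :=
      tendsto_finsetSum _ fun i _ => (h1 (e i)).const_mul _
    have e1 : (inner ℝ u γ : ℝ) = ∑ i, u i * (ψ (e i)).im := by
      simp [PiLp.inner_apply, γ, mul_comm]
    rw [e1]
    refine this.congr fun j => ?_
    simp_rw [← integral_const_mul, hin]
    rw [← integral_finsetSum _ fun i _ => (hi1 j i).const_mul (u i)]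
    refine integral_congr_ae (.of_forall fun x => ?_)
    simp [PiLp.inner_apply, mul_comm]
  refine ⟨γ, A, Matrix.PosSemidef.of_dotProduct_mulVec_nonneg ?_ fun x => ?_, fun u => ?_⟩
  · ext i k
    rw [Matrix.conjTranspose_apply, star_trivial]
    simp only [A, add_comm (e k)]
    ring
  · have := hq (WithLp.toLp 2 x)
    simp only [star_trivial]
    refine le_of_le_of_eq ?_ this.symm
    exact ge_of_tendsto' (h2 _) fun j => integral_nonneg fun y => sq_nonneg _
  · rw [hγ, hq]
    apply Complex.ext <;> simp [neg_div]

/-! ### Independent increments and the characteristic exponent -/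

namespace IsLevyProcess

variable {n : ℕ} {Ω : Type*} {mΩ : MeasurableSpace Ω} {P : Measure Ω} {ℱ : Filtration ℝ≥0 mΩ}
  {X : ℝ≥0 → Ω → EuclideanSpace ℝ (Fin n)}

theorem measurable (hX : IsLevyProcess X ℱ P) (t : ℝ≥0) : Measurable (X t) :=
  (hX.adapted t).mono (ℱ.le t) le_rfl

theorem measure_inter_sub_preimage (hX : IsLevyProcess X ℱ P) {s t : ℝ≥0} (hst : s ≤ t)
    {B : Set Ω} (hB : MeasurableSet[ℱ s] B) {S : Set (EuclideanSpace ℝ (Fin n))}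
    (hS : MeasurableSet S) :
    P (B ∩ (X t - X s) ⁻¹' S) = P B * P ((X t - X s) ⁻¹' S) := by
  have h := hX.indep s (t - s)
  rw [add_tsub_cancel_of_le hst] at h
  rw [Set.inter_comm, (Indep_iff _ _ _).1 h _ _ ⟨S, hS, rfl⟩ hB, mul_comm]

/-- The latest increment is independent of the past at its left endpoint, where all earlier
increments are measurable; induction on the largest index peels it off. -/
theorem hasIndepIncrements [IsProbabilityMeasure P] (hX : IsLevyProcess X ℱ P) :
    HasIndepIncrements X P := by
  refine .of_nat fun t ht _ => ?_
  rw [iIndepFun_iff_measure_inter_preimage_eq_mul]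
  intro S
  induction S using Finset.induction_on_max with
  | empty => simp
  | insert a S hS ih =>
    intro sets H
    have haS : a ∉ S := fun h => lt_irrefl _ (hS a h)
    rw [Finset.prod_insert haS, Finset.set_biInter_insert, Set.inter_comm, mul_comm,
      ← ih fun i hi => H i (Finset.mem_insert_of_mem hi)]
    refine hX.measure_inter_sub_preimage (ht a.le_succ) ?_ (H a (Finset.mem_insert_self _ _))
    refine Finset.measurableSet_biInter _ fun i hi => ?_
    have h1 : Measurable[ℱ (t a)] (X (t (i + 1))) :=
      (hX.adapted _).mono (ℱ.mono (ht (hS i hi))) le_rfl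
    have h2 : Measurable[ℱ (t a)] (X (t i)) :=
      (hX.adapted _).mono (ℱ.mono (ht (hS i hi).le)) le_rfl
    exact (h1.sub h2) (H i (Finset.mem_insert_of_mem hi))

theorem charFun_add [IsProbabilityMeasure P] (hX : IsLevyProcess X ℱ P) (s t : ℝ≥0)
    (u : EuclideanSpace ℝ (Fin n)) :
    charFun (P.map (X (s + t))) u = charFun (P.map (X s)) u * charFun (P.map (X t)) u := by
  have hi : IndepFun (X (s + t) - X s) (X s) P := by
    rw [IndepFun_iff_Indep]
    exact indep_of_indep_of_le_right (hX.indep s t) (hX.adapted s).comap_le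
  have h := hi.charFun_map_add_eq_mul ((hX.measurable _).sub (hX.measurable _)).aemeasurable
    (hX.measurable _).aemeasurable
  rw [sub_add_cancel, (hX.stationary s t).map_eq] at h
  rw [h, Pi.mul_apply, mul_comm]

theorem charFun_zero_time [IsProbabilityMeasure P] (hX : IsLevyProcess X ℱ P)
    (u : EuclideanSpace ℝ (Fin n)) : charFun (P.map (X 0)) u = 1 := by
  rw [charFun_apply, integral_map (hX.measurable 0).aemeasurable (by fun_prop)]
  rw [integral_congr_ae (g := fun _ => 1)]
  · simp
  · filter_upwards [hX.zero] with ω hω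
    simp [hω]

/-- Dominated convergence along almost every path, the integrand having modulus 1. -/
theorem continuous_charFun [IsProbabilityMeasure P] (hX : IsLevyProcess X ℱ P)
    (hcont : ∀ᵐ ω ∂P, Continuous fun t => X t ω) (u : EuclideanSpace ℝ (Fin n)) :
    Continuous fun t => charFun (P.map (X t)) u := by
  have h : ∀ t, charFun (P.map (X t)) u
      = ∫ ω, Complex.exp ((inner ℝ (X t ω) u : ℝ) * Complex.I) ∂P := fun t => by
    rw [charFun_apply, integral_map (hX.measurable t).aemeasurable (by fun_prop)]
  simp_rw [h]
  refine continuous_of_dominated (bound := fun _ => 1) (fun t => ?_) (fun t => ?_)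
    (integrable_const _) ?_
  · have := hX.measurable t
    fun_prop
  · exact .of_forall fun ω => (Complex.norm_exp_ofReal_mul_I _).le
  · filter_upwards [hcont] with ω hω
    fun_prop

theorem exists_charFun_eq_exp [IsProbabilityMeasure P] (hX : IsLevyProcess X ℱ P)
    (hcont : ∀ᵐ ω ∂P, Continuous fun t => X t ω) :
    ∃ ψ : EuclideanSpace ℝ (Fin n) → ℂ, ∀ (t : ℝ≥0) u,
      charFun (P.map (X t)) u = Complex.exp (ψ u * ((t : ℝ) : ℂ)) := by
  choose ψ hψ using fun u => exists_eq_exp_mul_of_continuous_of_add (hX.continuous_charFun hcont u)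
    (hX.charFun_zero_time u) (fun s t => hX.charFun_add s t u)
  exact ⟨ψ, fun t u => hψ u t⟩

/-- Turns a statement about the whole path, small oscillation on a grid, into one about the law of a
single increment. -/
theorem measure_forall_norm_increment_le [IsProbabilityMeasure P] (hX : IsLevyProcess X ℱ P)
    (h : ℝ≥0) (ε : ℝ) (j : ℕ) :
    P {ω | ∀ k < j, ‖X (k * h + h) ω - X (k * h) ω‖ ≤ ε} = P {ω | ‖X h ω‖ ≤ ε} ^ j := by
  induction j with
  | zero => simp
  | succ j ih =>
    have hle : ((j : ℝ≥0) * h) ≤ j * h + h := le_self_add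
    have hS : MeasurableSet {x : EuclideanSpace ℝ (Fin n) | ‖x‖ ≤ ε} :=
      measurableSet_le measurable_norm measurable_const
    have hB : MeasurableSet[ℱ (j * h)] {ω | ∀ k < j, ‖X (k * h + h) ω - X (k * h) ω‖ ≤ ε} := by
      have e : {ω | ∀ k < j, ‖X (k * h + h) ω - X (k * h) ω‖ ≤ ε}
          = ⋂ k ∈ Finset.range j, (X (k * h + h) - X (k * h)) ⁻¹' {x | ‖x‖ ≤ ε} := by
        ext ω; simp
      rw [e]
      refine Finset.measurableSet_biInter _ fun k hk => ?_
      have hk : ((k : ℝ≥0) * h + h) ≤ j * h := by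
        rw [← add_one_mul]
        gcongr
        exact_mod_cast Finset.mem_range.1 hk
      have h1 : Measurable[ℱ (j * h)] (X (k * h + h)) :=
        (hX.adapted _).mono (ℱ.mono hk) le_rfl
      have h2 : Measurable[ℱ (j * h)] (X (k * h)) :=
        (hX.adapted _).mono (ℱ.mono (le_self_add.trans hk)) le_rfl
      exact (h1.sub h2) hS
    have e : {ω | ∀ k < j + 1, ‖X (k * h + h) ω - X (k * h) ω‖ ≤ ε}
        = {ω | ∀ k < j, ‖X (k * h + h) ω - X (k * h) ω‖ ≤ ε} ∩
          (X (j * h + h) - X (j * h)) ⁻¹' {x | ‖x‖ ≤ ε} := by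
      ext ω
      simp only [Set.mem_ofPred_eq, Set.mem_inter_iff, Set.mem_preimage, Pi.sub_apply]
      exact Nat.forall_lt_succ_right
    rw [e, hX.measure_inter_sub_preimage hle hB hS, ih, pow_succ,
      (hX.stationary _ h).measure_mem_eq hS]
    rfl

/-- Continuity of paths forces `N * P (ε < ‖X (1 / N)‖)` to vanish as `N → ∞`. -/
theorem tendsto_mul_measure_norm_gt [IsProbabilityMeasure P] (hX : IsLevyProcess X ℱ P)
    (hcont : ∀ᵐ ω ∂P, Continuous fun t => X t ω) {ε : ℝ} (hε : 0 < ε) :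
    Tendsto (fun m : ℕ => (m : ℝ) * P.real {ω | ε < ‖X (m : ℝ≥0)⁻¹ ω‖}) atTop (𝓝 0) := by
  set p : ℕ → ℝ := fun m => P.real {ω | ε < ‖X (m : ℝ≥0)⁻¹ ω‖} with hp
  let A : ℕ → Set Ω := fun m =>
    {ω | ∀ k < m, ‖X (k * (m : ℝ≥0)⁻¹ + (m : ℝ≥0)⁻¹) ω - X (k * (m : ℝ≥0)⁻¹) ω‖ ≤ ε}
  have hAm : ∀ m, MeasurableSet (A m) := fun m => by
    have e : A m = ⋂ k ∈ Finset.range m, {ω |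
        ‖X (k * (m : ℝ≥0)⁻¹ + (m : ℝ≥0)⁻¹) ω - X (k * (m : ℝ≥0)⁻¹) ω‖ ≤ ε} := by
      ext ω; simp [A]
    rw [e]
    exact Finset.measurableSet_biInter _ fun k _ => measurableSet_le
      ((hX.measurable _).sub (hX.measurable _)).norm measurable_const
  -- By uniform continuity on `[0, 1]`, almost every `ω` lies in `A m` for all large `m`.
  have hA1 : Tendsto (fun m => P (A m)) atTop (𝓝 (P Set.univ)) := by
    refine tendsto_measure_of_ae_tendsto_indicator_of_isFiniteMeasure _ .univ hAm ?_
    filter_upwards [hcont] with ω hω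
    have huc := (isCompact_Icc (a := (0 : ℝ≥0)) (b := 1)).uniformContinuousOn_of_continuous
      hω.continuousOn
    obtain ⟨δ, hδ, h⟩ := Metric.uniformContinuousOn_iff.1 huc ε hε
    have hinv : ∀ᶠ m : ℕ in atTop, ((m : ℝ)⁻¹) < δ :=
      (tendsto_inv_atTop_nhds_zero_nat (𝕜 := ℝ)).eventually_lt_const hδ
    filter_upwards [hinv] with m hm
    simp only [Set.mem_univ, iff_true]
    intro k hk
    have hk1 : (k : ℝ≥0) * (m : ℝ≥0)⁻¹ + (m : ℝ≥0)⁻¹ ≤ 1 := by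
      rw [← add_one_mul, ← div_eq_mul_inv]
      exact div_le_one_of_le₀ (by exact_mod_cast hk) (by positivity)
    rw [← dist_eq_norm]
    refine (h _ ⟨zero_le, hk1⟩ _ ⟨zero_le, le_self_add.trans hk1⟩ ?_).le
    rw [NNReal.dist_eq]
    push_cast
    rw [add_sub_cancel_left, abs_of_nonneg (by positivity)]
    exact hm
  have hPA : ∀ m, P.real (A m) = (1 - p m) ^ m := fun m => by
    have hc : {ω | ‖X (m : ℝ≥0)⁻¹ ω‖ ≤ ε} = {ω | ε < ‖X (m : ℝ≥0)⁻¹ ω‖}ᶜ := by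
      ext ω; simp
    rw [Measure.real, hX.measure_forall_norm_increment_le, ENNReal.toReal_pow, hc]
    congr 1
    exact probReal_compl_eq_one_sub
      (measurableSet_lt measurable_const (hX.measurable _).norm)
  have hA2 : Tendsto (fun m => (P.real (A m))⁻¹ - 1) atTop (𝓝 0) := by
    have h1 : Tendsto (fun m => P.real (A m)) atTop (𝓝 1) := by
      have := (ENNReal.tendsto_toReal (measure_ne_top P Set.univ)).comp hA1
      simpa [Measure.real, Function.comp_def] using this
    simpa using (h1.inv₀ one_ne_zero).sub_const 1
  -- Bernoulli gives `1 + m p ≤ (1 + p)^m`, and `(1 + p)^m (1 - p)^m ≤ 1`; hence `m p ≤ P(A m)⁻¹ -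
  -- 1`.
  refine squeeze_zero' (.of_forall fun m => mul_nonneg (by positivity) measureReal_nonneg) ?_ hA2
  have hpos : ∀ᶠ m in atTop, 0 < P (A m) := hA1.eventually_const_lt (by simp)
  filter_upwards [hpos] with m hm
  have hm' : 0 < P.real (A m) := ENNReal.toReal_pos hm.ne' (measure_ne_top _ _)
  have hp0 : 0 ≤ p m := measureReal_nonneg
  have hp1 : p m ≤ 1 := measureReal_le_one
  have hb : 1 + m * p m ≤ (1 + p m) ^ m := one_add_mul_le_pow (by linarith) m
  have hmul : (1 + p m) ^ m * P.real (A m) ≤ 1 := by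
    rw [hPA, ← mul_pow]
    exact pow_le_one₀ (mul_nonneg (by linarith) (by linarith)) (by nlinarith)
  have : 1 + m * p m ≤ (P.real (A m))⁻¹ := by
    rw [le_inv_comm₀ (by positivity) hm', ← one_div, le_div_iff₀ (by positivity)]
    calc P.real (A m) * (1 + m * p m) ≤ P.real (A m) * (1 + p m) ^ m := by gcongr
      _ ≤ 1 := by linarith
  linarith

/-- The characteristic exponent of a Lévy process with continuous paths is Gaussian. -/
theorem exists_gaussian_exponent [IsProbabilityMeasure P] (hX : IsLevyProcess X ℱ P)
    (hcont : ∀ᵐ ω ∂P, Continuous fun t => X t ω) :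
    ∃ (γ : EuclideanSpace ℝ (Fin n)) (A : Matrix (Fin n) (Fin n) ℝ), A.PosSemidef ∧
      ∀ (t : ℝ≥0) (u : EuclideanSpace ℝ (Fin n)), charFun (P.map (X t)) u =
        Complex.exp (((inner ℝ u γ : ℝ) * Complex.I - ((u ⬝ᵥ A *ᵥ u : ℝ) : ℂ) / 2)
          * ((t : ℝ) : ℂ)) := by
  obtain ⟨ψ, hψ⟩ := hX.exists_charFun_eq_exp hcont
  have hε : ∀ j : ℕ, (0 : ℝ) < 1 / (j + 1) := fun j => by positivity
  -- Diagonal choice: the radius `1 / (j + 1)` and the scaled tail mass vanish together. The bound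
  -- `j + 1 ≤ N` gives both `N → ∞` and `N ≠ 0`.
  have hN : ∀ j : ℕ, ∃ N : ℕ, j + 1 ≤ N ∧
      (N : ℝ) * P.real {ω | 1 / ((j : ℝ) + 1) < ‖X (N : ℝ≥0)⁻¹ ω‖} < 1 / (j + 1) := fun j =>
    ((eventually_ge_atTop (j + 1)).and
      ((hX.tendsto_mul_measure_norm_gt hcont (hε j)).eventually_lt_const (hε j))).exists
  choose N hjN hNε using hN
  have hNt : Tendsto N atTop atTop :=
    tendsto_atTop_mono (fun j => (Nat.le_succ j).trans (hjN j)) tendsto_id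
  set μ : ℕ → Measure (EuclideanSpace ℝ (Fin n)) := fun j => P.map (X (N j : ℝ≥0)⁻¹) with hμ
  have hμp : ∀ j, IsProbabilityMeasure (μ j) := fun j =>
    Measure.isProbabilityMeasure_map (hX.measurable _).aemeasurable
  set B : ℕ → Set (EuclideanSpace ℝ (Fin n)) := fun j => {x | ‖x‖ ≤ 1 / ((j : ℝ) + 1)} with hB
  have hBm : ∀ j, MeasurableSet (B j) := fun j =>
    measurableSet_le measurable_norm measurable_const
  have hμB : ∀ j, (N j : ℝ) * (μ j).real (B j)ᶜ < 1 / (j + 1) := fun j => by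
    rw [hμ, map_measureReal_apply (hX.measurable _) (hBm j).compl]
    convert hNε j using 4
    ext ω; simp [hB]
  obtain ⟨γ, A, hA, h⟩ := exists_gaussian_exponent_of_small_support (ψ := ψ)
    (ν := fun j => (N j : ℝ≥0) • (μ j).restrict (B j))
    (tendsto_one_div_add_atTop_nhds_zero_nat (𝕜 := ℝ))
    (fun j => Measure.ae_smul_measure (ae_restrict_mem (hBm j)) _) (fun u => by
      let f : EuclideanSpace ℝ (Fin n) → ℂ := fun x =>
        Complex.exp ((inner ℝ u x : ℝ) * Complex.I) - 1
      have hf2 : ∀ x, ‖f x‖ ≤ 2 := fun x => by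
        refine (norm_sub_le _ _).trans ?_
        rw [Complex.norm_exp_ofReal_mul_I]; norm_num
      have hfi : ∀ j, Integrable f (μ j) := fun j =>
        Integrable.of_bound (by fun_prop) 2 (.of_forall hf2)
      -- `N (exp (ψ u / N) - 1)` is a difference quotient of `x ↦ exp (ψ u * x)` at 0.
      have hlim : Tendsto (fun j => (N j : ℝ) • ∫ x, f x ∂μ j) atTop (𝓝 (ψ u)) := by
        have hd : HasDerivAt (fun x : ℝ => Complex.exp (ψ u * (x : ℂ))) (ψ u) 0 := by
          simpa using ((Complex.ofRealCLM.hasDerivAt (x := (0 : ℝ))).const_mul (ψ u)).cexp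
        have h0 : Tendsto (fun j => ((N j : ℝ))⁻¹) atTop (𝓝[≠] 0) := by
          refine tendsto_nhdsWithin_iff.2
            ⟨(tendsto_inv_atTop_nhds_zero_nat (𝕜 := ℝ)).comp hNt, .of_forall fun j => ?_⟩
          have : (N j : ℝ) ≠ 0 := by
            have := hjN j
            exact_mod_cast (by omega : N j ≠ 0)
          simpa using this
        refine (hd.tendsto_slope_zero.comp h0).congr fun j => ?_
        have hI : ∫ x, f x ∂μ j = charFun (μ j) u - 1 := by
          simp only [f]
          rw [integral_sub, charFun_apply]
          · simp [real_inner_comm]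
          · exact Integrable.of_bound (by fun_prop) 1
              (.of_forall fun x => (Complex.norm_exp_ofReal_mul_I _).le)
          · exact integrable_const _
        rw [hI, hμ, hψ]
        simp
      -- Cutting off to the ball costs at most `2 N_j μ_j(B_jᶜ) < 2 / (j + 1)`.
      have herr : Tendsto (fun j => (N j : ℝ) • ∫ x in (B j)ᶜ, f x ∂μ j) atTop (𝓝 0) := by
        refine squeeze_zero_norm (a := fun j : ℕ => 2 * (1 / ((j : ℝ) + 1))) (fun j => ?_) ?_
        · have h1 : ‖∫ x in (B j)ᶜ, f x ∂μ j‖ ≤ 2 * (μ j).real (B j)ᶜ :=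
            norm_setIntegral_le_of_norm_le_const (measure_lt_top _ _) fun x _ => hf2 x
          rw [norm_smul, Real.norm_natCast]
          calc (N j : ℝ) * ‖∫ x in (B j)ᶜ, f x ∂μ j‖
              ≤ N j * (2 * (μ j).real (B j)ᶜ) := by gcongr
            _ ≤ _ := by linarith [hμB j]
        · simpa using (tendsto_one_div_add_atTop_nhds_zero_nat (𝕜 := ℝ)).const_mul 2
      have := hlim.sub herr
      rw [sub_zero] at this
      refine this.congr fun j => ?_
      rw [← smul_sub, ← integral_add_compl (hBm j) (hfi j), add_sub_cancel_right,
        integral_smul_nnreal_measure]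
      rfl)
  exact ⟨γ, A, hA, fun t u => by rw [hψ, h]⟩

end IsLevyProcess

/-! ### Conclusion -/

theorem mainTheorem8 {n : ℕ} {Ω : Type*} {mΩ : MeasurableSpace Ω} (P : Measure Ω)
    [IsProbabilityMeasure P] (ℱ : Filtration ℝ≥0 mΩ) (X : ℝ≥0 → Ω → EuclideanSpace ℝ (Fin n))
    (hX : IsLevyProcess X ℱ P) (hcont : ∀ᵐ ω ∂P, Continuous fun t => X t ω) :
    ∃ (γ : EuclideanSpace ℝ (Fin n)) (A : Matrix (Fin n) (Fin n) ℝ),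
      A.PosSemidef ∧
      (∀ (t : ℝ≥0) (u : EuclideanSpace ℝ (Fin n)),
        ∫ ω, Complex.exp (Complex.I * ((inner ℝ u (X t ω) : ℝ) : ℂ)) ∂P =
          Complex.exp (Complex.I * ((inner ℝ u γ : ℝ) : ℂ) * ((t : ℝ) : ℂ)
            - 1 / 2 * ((inner ℝ u (Matrix.toEuclideanCLM (𝕜 := ℝ) A u) : ℝ) : ℂ)
              * ((t : ℝ) : ℂ))) ∧
      IsArithmeticBrownianMotion X γ A P := by
  obtain ⟨γ, A, hA, h⟩ := hX.exists_gaussian_exponent hcont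
  refine ⟨γ, A, hA, fun t u => ?_, hX.zero, hX.hasIndepIncrements, fun s t hst => ?_, hcont⟩
  · have h1 := h t u
    rw [charFun_apply, integral_map (hX.measurable t).aemeasurable (by fun_prop)] at h1
    simp_rw [← real_inner_comm u (X t _), mul_comm Complex.I]
    rw [Matrix.inner_toEuclideanCLM]
    rw [h1]
    congr 1
    ring
  · refine ⟨((hX.measurable _).sub (hX.measurable _)).aemeasurable, ?_⟩
    have hst' : (X t - X s) = X (s + (t - s)) - X s := by rw [add_tsub_cancel_of_le hst]
    have hts : 0 ≤ (t : ℝ) - s := sub_nonneg.2 hst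
    rw [hst', (hX.stationary s (t - s)).map_eq]
    have := Measure.isProbabilityMeasure_map (μ := P) (hX.measurable (t - s)).aemeasurable
    -- Comparing characteristic functions rather than densities covers singular `A` too.
    refine Measure.ext_of_charFun ?_
    ext u
    rw [h, charFun_multivariateGaussian (hA.smul hts)]
    congr 1
    rw [NNReal.coe_sub hst, real_inner_smul_right, Matrix.smul_mulVec, dotProduct_smul]
    push_cast [smul_eq_mul]
    ring
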